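/- Theorem (Coherence for Symmetric Monoidal Categories). Let $A$ be a set and let $\mathcal{F}(A)$ be the free symmetric monoidal category on $A$: its objects are the formal expressions built from the elements of $A$, a formal unit $I$ and a formal binary tensor product $\otimes$; its morphisms are the formal expressions built from identities, associators $\alpha$, unitors $\lambda,\rho$, their inverses and symmetries $\beta$ by composition and $\otimes$, modulo the congruence generated by the axioms of symmetric monoidal categories. For an object $X$ let $|X|$ be the number of occurrences of elements of $A$ in $X$. Every morphism $f : X \to Y$ has an underlying permutation $\pi(f) : \{1,\dots,|X|\} \to \{1,\dots,|Y|\}$, a bijection (so $|X|=|Y|$), given by $\pi(g\circ f)=\pi(g)\circ\pi(f)$ and $\pi(f\otimes g)=\pi(f)\oplus\pi(g)$, where $\oplus$ lets the first permutation act on the first block and the second one on the second block; $\pi$ is the identity permutation on identities, associators, unitors and their inverses; and $\pi(\beta_{X,Y})$ is the block transposition that sends $i\le |X|$ to $|Y|+i$ and $|X|+j$ to $j$ for $j\le |Y|$. If $f,g : X \to Y$ are morphisms of $\mathcal{F}(A)$ with the same source and target and $\pi(f)=\pi(g)$, then $f=g$. -/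

import Mathlib

open CategoryTheory MonoidalCategory

universe u

/-- Objects of the free symmetric monoidal category on a set `A`: formal expressions built from the
elements of `A`, a formal unit and a formal binary tensor product. -/
inductive FreeSymMon (A : Type u) : Type u
  | of : A → FreeSymMon A
  | unit : FreeSymMon A
  | tensor : FreeSymMon A → FreeSymMon A → FreeSymMon A

namespace FreeSymMon

variable {A : Type u}

/-- The number of occurrences of elements of `A` in an object. -/
def length : FreeSymMon A → ℕ
  | of _ => 1
  | unit => 0
  | tensor X Y => X.length + Y.length

/-- Formal composites and tensor products of identities, associators, unitors, their inverses, and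
symmetries. -/
inductive Hom : FreeSymMon A → FreeSymMon A → Type u
  | id (X : FreeSymMon A) : Hom X X
  | comp {X Y Z : FreeSymMon A} (f : Hom X Y) (g : Hom Y Z) : Hom X Z
  | tensor {W X Y Z : FreeSymMon A} (f : Hom W Y) (g : Hom X Z) : Hom (W.tensor X) (Y.tensor Z)
  | α_hom (X Y Z : FreeSymMon A) : Hom ((X.tensor Y).tensor Z) (X.tensor (Y.tensor Z))
  | α_inv (X Y Z : FreeSymMon A) : Hom (X.tensor (Y.tensor Z)) ((X.tensor Y).tensor Z)
  | l_hom (X : FreeSymMon A) : Hom (unit.tensor X) X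
  | l_inv (X : FreeSymMon A) : Hom X (unit.tensor X)
  | ρ_hom (X : FreeSymMon A) : Hom (X.tensor unit) X
  | ρ_inv (X : FreeSymMon A) : Hom X (X.tensor unit)
  | β (X Y : FreeSymMon A) : Hom (X.tensor Y) (Y.tensor X)

/-- The congruence on formal morphisms generated by the axioms of symmetric monoidal categories. -/
inductive HomEquiv : ∀ {X Y : FreeSymMon A}, Hom X Y → Hom X Y → Prop
  | refl {X Y : FreeSymMon A} (f : Hom X Y) : HomEquiv f f
  | symm {X Y : FreeSymMon A} {f g : Hom X Y} : HomEquiv f g → HomEquiv g f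
  | trans {X Y : FreeSymMon A} {f g h : Hom X Y} : HomEquiv f g → HomEquiv g h → HomEquiv f h
  | comp {X Y Z : FreeSymMon A} {f f' : Hom X Y} {g g' : Hom Y Z} :
      HomEquiv f f' → HomEquiv g g' → HomEquiv (f.comp g) (f'.comp g')
  | tensor {W X Y Z : FreeSymMon A} {f f' : Hom W Y} {g g' : Hom X Z} :
      HomEquiv f f' → HomEquiv g g' → HomEquiv (f.tensor g) (f'.tensor g')
  | id_comp {X Y : FreeSymMon A} (f : Hom X Y) : HomEquiv ((Hom.id X).comp f) f
  | comp_id {X Y : FreeSymMon A} (f : Hom X Y) : HomEquiv (f.comp (Hom.id Y)) f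
  | assoc {W X Y Z : FreeSymMon A} (f : Hom W X) (g : Hom X Y) (h : Hom Y Z) :
      HomEquiv ((f.comp g).comp h) (f.comp (g.comp h))
  | tensor_id (X Y : FreeSymMon A) :
      HomEquiv ((Hom.id X).tensor (Hom.id Y)) (Hom.id (X.tensor Y))
  | tensor_comp {X₁ Y₁ Z₁ X₂ Y₂ Z₂ : FreeSymMon A} (f₁ : Hom X₁ Y₁) (f₂ : Hom X₂ Y₂)
      (g₁ : Hom Y₁ Z₁) (g₂ : Hom Y₂ Z₂) :
      HomEquiv ((f₁.tensor f₂).comp (g₁.tensor g₂)) ((f₁.comp g₁).tensor (f₂.comp g₂))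
  | α_hom_inv (X Y Z : FreeSymMon A) :
      HomEquiv ((Hom.α_hom X Y Z).comp (Hom.α_inv X Y Z)) (Hom.id _)
  | α_inv_hom (X Y Z : FreeSymMon A) :
      HomEquiv ((Hom.α_inv X Y Z).comp (Hom.α_hom X Y Z)) (Hom.id _)
  | α_naturality {X₁ X₂ X₃ Y₁ Y₂ Y₃ : FreeSymMon A}
      (f₁ : Hom X₁ Y₁) (f₂ : Hom X₂ Y₂) (f₃ : Hom X₃ Y₃) :
      HomEquiv (((f₁.tensor f₂).tensor f₃).comp (Hom.α_hom Y₁ Y₂ Y₃))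
        ((Hom.α_hom X₁ X₂ X₃).comp (f₁.tensor (f₂.tensor f₃)))
  | l_hom_inv (X : FreeSymMon A) : HomEquiv ((Hom.l_hom X).comp (Hom.l_inv X)) (Hom.id _)
  | l_inv_hom (X : FreeSymMon A) : HomEquiv ((Hom.l_inv X).comp (Hom.l_hom X)) (Hom.id _)
  | l_naturality {X Y : FreeSymMon A} (f : Hom X Y) :
      HomEquiv (((Hom.id unit).tensor f).comp (Hom.l_hom Y)) ((Hom.l_hom X).comp f)
  | ρ_hom_inv (X : FreeSymMon A) : HomEquiv ((Hom.ρ_hom X).comp (Hom.ρ_inv X)) (Hom.id _)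
  | ρ_inv_hom (X : FreeSymMon A) : HomEquiv ((Hom.ρ_inv X).comp (Hom.ρ_hom X)) (Hom.id _)
  | ρ_naturality {X Y : FreeSymMon A} (f : Hom X Y) :
      HomEquiv ((f.tensor (Hom.id unit)).comp (Hom.ρ_hom Y)) ((Hom.ρ_hom X).comp f)
  | pentagon (W X Y Z : FreeSymMon A) :
      HomEquiv
        (((Hom.α_hom W X Y).tensor (Hom.id Z)).comp
          ((Hom.α_hom W (X.tensor Y) Z).comp ((Hom.id W).tensor (Hom.α_hom X Y Z))))
        ((Hom.α_hom (W.tensor X) Y Z).comp (Hom.α_hom W X (Y.tensor Z)))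
  | triangle (X Y : FreeSymMon A) :
      HomEquiv ((Hom.α_hom X unit Y).comp ((Hom.id X).tensor (Hom.l_hom Y)))
        ((Hom.ρ_hom X).tensor (Hom.id Y))
  | β_naturality {X₁ X₂ Y₁ Y₂ : FreeSymMon A} (f : Hom X₁ Y₁) (g : Hom X₂ Y₂) :
      HomEquiv ((f.tensor g).comp (Hom.β Y₁ Y₂)) ((Hom.β X₁ X₂).comp (g.tensor f))
  | β_symmetry (X Y : FreeSymMon A) :
      HomEquiv ((Hom.β X Y).comp (Hom.β Y X)) (Hom.id (X.tensor Y))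
  | hexagon_forward (X Y Z : FreeSymMon A) :
      HomEquiv
        ((Hom.α_hom X Y Z).comp ((Hom.β X (Y.tensor Z)).comp (Hom.α_hom Y Z X)))
        (((Hom.β X Y).tensor (Hom.id Z)).comp
          ((Hom.α_hom Y X Z).comp ((Hom.id Y).tensor (Hom.β X Z))))
  | hexagon_reverse (X Y Z : FreeSymMon A) :
      HomEquiv
        ((Hom.α_inv X Y Z).comp ((Hom.β (X.tensor Y) Z).comp (Hom.α_inv Z X Y)))
        (((Hom.id X).tensor (Hom.β Y Z)).comp
          ((Hom.α_inv X Z Y).comp ((Hom.β X Z).tensor (Hom.id Y))))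

instance setoidHom (X Y : FreeSymMon A) : Setoid (Hom X Y) :=
  ⟨HomEquiv, ⟨HomEquiv.refl, HomEquiv.symm, HomEquiv.trans⟩⟩

/-- The free symmetric monoidal category on the set `A`. -/
instance instCategory : Category.{u} (FreeSymMon A) where
  Hom X Y := Quotient (setoidHom X Y)
  id X := ⟦Hom.id X⟧
  comp := Quotient.map₂ Hom.comp (fun _ _ hf _ _ hg => HomEquiv.comp hf hg)
  id_comp := by
    rintro X Y ⟨f⟩
    exact Quotient.sound (HomEquiv.id_comp f)
  comp_id := by
    rintro X Y ⟨f⟩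
    exact Quotient.sound (HomEquiv.comp_id f)
  assoc := by
    rintro W X Y Z ⟨f⟩ ⟨g⟩ ⟨h⟩
    exact Quotient.sound (HomEquiv.assoc f g h)

instance instMonoidalCategoryStruct : MonoidalCategoryStruct (FreeSymMon A) where
  tensorObj := FreeSymMon.tensor
  tensorUnit := FreeSymMon.unit
  tensorHom := Quotient.map₂ Hom.tensor (fun _ _ hf _ _ hg => HomEquiv.tensor hf hg)
  whiskerLeft X _ _ f :=
    Quotient.map₂ Hom.tensor (fun _ _ hf _ _ hg => HomEquiv.tensor hf hg) ⟦Hom.id X⟧ f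
  whiskerRight f Y :=
    Quotient.map₂ Hom.tensor (fun _ _ hf _ _ hg => HomEquiv.tensor hf hg) f ⟦Hom.id Y⟧
  associator X Y Z :=
    ⟨⟦Hom.α_hom X Y Z⟧, ⟦Hom.α_inv X Y Z⟧,
      Quotient.sound (HomEquiv.α_hom_inv X Y Z), Quotient.sound (HomEquiv.α_inv_hom X Y Z)⟩
  leftUnitor X :=
    ⟨⟦Hom.l_hom X⟧, ⟦Hom.l_inv X⟧,
      Quotient.sound (HomEquiv.l_hom_inv X), Quotient.sound (HomEquiv.l_inv_hom X)⟩
  rightUnitor X :=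
    ⟨⟦Hom.ρ_hom X⟧, ⟦Hom.ρ_inv X⟧,
      Quotient.sound (HomEquiv.ρ_hom_inv X), Quotient.sound (HomEquiv.ρ_inv_hom X)⟩

instance instMonoidalCategory : MonoidalCategory (FreeSymMon A) :=
  MonoidalCategory.ofTensorHom
    (id_tensorHom_id := fun X Y => Quotient.sound (HomEquiv.tensor_id X Y))
    (id_tensorHom := fun _ _ _ _ => rfl)
    (tensorHom_id := fun _ _ => rfl)
    (tensorHom_comp_tensorHom := by
      rintro X₁ Y₁ Z₁ X₂ Y₂ Z₂ ⟨f₁⟩ ⟨f₂⟩ ⟨g₁⟩ ⟨g₂⟩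
      exact Quotient.sound (HomEquiv.tensor_comp f₁ f₂ g₁ g₂))
    (associator_naturality := by
      rintro X₁ X₂ X₃ Y₁ Y₂ Y₃ ⟨f₁⟩ ⟨f₂⟩ ⟨f₃⟩
      exact Quotient.sound (HomEquiv.α_naturality f₁ f₂ f₃))
    (leftUnitor_naturality := by
      rintro X Y ⟨f⟩
      exact Quotient.sound (HomEquiv.l_naturality f))
    (rightUnitor_naturality := by
      rintro X Y ⟨f⟩
      exact Quotient.sound (HomEquiv.ρ_naturality f))
    (pentagon := fun W X Y Z => Quotient.sound (HomEquiv.pentagon W X Y Z))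
    (triangle := fun X Y => Quotient.sound (HomEquiv.triangle X Y))

instance instSymmetricCategory : SymmetricCategory (FreeSymMon A) where
  braiding X Y :=
    ⟨⟦Hom.β X Y⟧, ⟦Hom.β Y X⟧,
      Quotient.sound (HomEquiv.β_symmetry X Y), Quotient.sound (HomEquiv.β_symmetry Y X)⟩
  braiding_naturality_right := by
    rintro X Y Z ⟨f⟩
    exact Quotient.sound (HomEquiv.β_naturality (Hom.id X) f)
  braiding_naturality_left := by
    rintro X Y ⟨f⟩ Z
    exact Quotient.sound (HomEquiv.β_naturality f (Hom.id Z))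
  hexagon_forward X Y Z := Quotient.sound (HomEquiv.hexagon_forward X Y Z)
  hexagon_reverse X Y Z := Quotient.sound (HomEquiv.hexagon_reverse X Y Z)
  symmetry X Y := Quotient.sound (HomEquiv.β_symmetry X Y)

/-- The sum `σ ⊕ τ` of two bijections: `σ` acts on the first block, `τ` on the second one. -/
def blockSum {m n m' n' : ℕ} (σ : Fin m ≃ Fin m') (τ : Fin n ≃ Fin n') :
    Fin (m + n) ≃ Fin (m' + n') :=
  (finSumFinEquiv.symm.trans (Equiv.sumCongr σ τ)).trans finSumFinEquiv

/-- The underlying permutation of a formal morphism: the occurrence of an atom at position `i` in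
the source is carried to position `f.perm i` of the target. -/
def Hom.perm : ∀ {X Y : FreeSymMon A}, Hom X Y → (Fin X.length ≃ Fin Y.length)
  | _, _, .id X => Equiv.refl (Fin X.length)
  | _, _, .comp f g => f.perm.trans g.perm
  | _, _, .tensor f g => blockSum f.perm g.perm
  | _, _, .α_hom X Y Z => finCongr (Nat.add_assoc X.length Y.length Z.length)
  | _, _, .α_inv X Y Z => finCongr (Nat.add_assoc X.length Y.length Z.length).symm
  | _, _, .l_hom X => finCongr (Nat.zero_add X.length)
  | _, _, .l_inv X => finCongr (Nat.zero_add X.length).symm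
  | _, _, .ρ_hom X => finCongr (Nat.add_zero X.length)
  | _, _, .ρ_inv X => finCongr (Nat.add_zero X.length).symm
  | _, _, .β X Y => (finAddFlip : Fin (X.length + Y.length) ≃ Fin (Y.length + X.length))

theorem blockSum_val {m n m' n' : ℕ} (σ : Fin m ≃ Fin m') (τ : Fin n ≃ Fin n') (i : Fin (m + n)) :
    (blockSum σ τ i).val = if h : i.val < m then (σ ⟨i.val, h⟩).val
      else m' + (τ ⟨i.val - m, by omega⟩).val := by
  refine Fin.addCases (fun j => ?_) (fun j => ?_) i
  · simp [blockSum]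
  · simp [blockSum]

theorem addFlip_val {m n : ℕ} (i : Fin (m + n)) :
    (finAddFlip i : Fin (n + m)).val = if i.val < m then n + i.val else i.val - m := by
  refine Fin.addCases (fun j => ?_) (fun j => ?_) i
  · simp
  · simp

theorem blockSum_refl (m n : ℕ) :
    blockSum (Equiv.refl (Fin m)) (Equiv.refl (Fin n)) =
      Equiv.refl (Fin (m + n)) := by
  ext ⟨i, hi⟩
  simp [blockSum_val]
  omega

theorem blockSum_trans {m n m' n' m'' n'' : ℕ} (σ : Fin m ≃ Fin m') (τ : Fin n ≃ Fin n')
    (σ' : Fin m' ≃ Fin m'') (τ' : Fin n' ≃ Fin n'') :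
    (blockSum σ τ).trans (blockSum σ' τ') =
      blockSum (σ.trans σ') (τ.trans τ') := by
  ext ⟨i, hi⟩
  simp [blockSum_val]
  split_ifs <;> first | rfl | omega | grind

theorem blockSum_assoc {m n p m' n' p' : ℕ} (σ : Fin m ≃ Fin m') (τ : Fin n ≃ Fin n')
    (υ : Fin p ≃ Fin p') :
    (blockSum (blockSum σ τ) υ).trans (finCongr (Nat.add_assoc m' n' p')) =
      (finCongr (Nat.add_assoc m n p)).trans (blockSum σ (blockSum τ υ)) := by
  ext ⟨i, hi⟩
  simp [blockSum_val]
  split_ifs <;> first | rfl | omega | grind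

theorem blockSum_zero_left {m m' : ℕ} (σ : Fin m ≃ Fin m') :
    (blockSum (Equiv.refl (Fin 0)) σ).trans (finCongr (Nat.zero_add m')) =
      (finCongr (Nat.zero_add m)).trans σ := by
  ext ⟨i, hi⟩
  simp [blockSum_val]

theorem blockSum_zero_right {m m' : ℕ} (σ : Fin m ≃ Fin m') :
    (blockSum σ (Equiv.refl (Fin 0))).trans (finCongr (Nat.add_zero m')) =
      (finCongr (Nat.add_zero m)).trans σ := by
  ext ⟨i, hi⟩
  exact (blockSum_val σ (Equiv.refl (Fin 0)) ⟨i, hi⟩).trans (dif_pos hi)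

theorem blockSum_pentagon (m n p q : ℕ) :
    (blockSum (finCongr (Nat.add_assoc m n p)) (Equiv.refl (Fin q))).trans
      ((finCongr (Nat.add_assoc m (n + p) q)).trans
        (blockSum (Equiv.refl (Fin m)) (finCongr (Nat.add_assoc n p q)))) =
      (finCongr (Nat.add_assoc (m + n) p q)).trans (finCongr (Nat.add_assoc m n (p + q))) := by
  ext ⟨i, hi⟩
  simp [blockSum_val]
  split_ifs <;> omega

theorem blockSum_triangle (m n : ℕ) :
    (finCongr (Nat.add_assoc m 0 n)).trans
      (blockSum (Equiv.refl (Fin m)) (finCongr (Nat.zero_add n))) =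
      blockSum (finCongr (Nat.add_zero m)) (Equiv.refl (Fin n)) := by
  ext ⟨i, hi⟩
  simp [blockSum_val]

theorem blockSum_flip {m n m' n' : ℕ} (σ : Fin m ≃ Fin m') (τ : Fin n ≃ Fin n') :
    (blockSum σ τ).trans finAddFlip =
      finAddFlip.trans (blockSum τ σ) := by
  ext ⟨i, hi⟩
  simp [blockSum_val, addFlip_val]
  split_ifs <;> first | rfl | omega | grind

theorem addFlip_addFlip (m n : ℕ) :
    (finAddFlip : Fin (m + n) ≃ Fin (n + m)).trans finAddFlip =
      Equiv.refl (Fin (m + n)) := by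
  ext ⟨i, hi⟩
  simp [addFlip_val]
  split_ifs <;> first | rfl | omega

theorem addFlip_hexagon_forward (m n p : ℕ) :
    (finCongr (Nat.add_assoc m n p)).trans
      ((finAddFlip : Fin (m + (n + p)) ≃ Fin (n + p + m)).trans (finCongr (Nat.add_assoc n p m))) =
      (blockSum (finAddFlip : Fin (m + n) ≃ Fin (n + m)) (Equiv.refl (Fin p))).trans
        ((finCongr (Nat.add_assoc n m p)).trans
          (blockSum (Equiv.refl (Fin n)) (finAddFlip : Fin (m + p) ≃ Fin (p + m)))) := by
  ext ⟨i, hi⟩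
  simp [blockSum_val, addFlip_val]
  split_ifs <;> first | rfl | omega

theorem addFlip_hexagon_reverse (m n p : ℕ) :
    (finCongr (Nat.add_assoc m n p).symm).trans
      ((finAddFlip : Fin (m + n + p) ≃ Fin (p + (m + n))).trans
        (finCongr (Nat.add_assoc p m n).symm)) =
      (blockSum (Equiv.refl (Fin m)) (finAddFlip : Fin (n + p) ≃ Fin (p + n))).trans
        ((finCongr (Nat.add_assoc m p n).symm).trans
          (blockSum (finAddFlip : Fin (m + p) ≃ Fin (p + m)) (Equiv.refl (Fin n)))) := by
  ext ⟨i, hi⟩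
  simp [blockSum_val, addFlip_val]
  split_ifs <;> first | rfl | omega

theorem Hom.perm_eq_of_homEquiv {X Y : FreeSymMon A} {f g : Hom X Y} (h : HomEquiv f g) :
    f.perm = g.perm := by
  induction h with
  | symm _ ih => exact ih.symm
  | trans _ _ ih₁ ih₂ => exact ih₁.trans ih₂
  | comp _ _ ih₁ ih₂ => exact congrArg₂ Equiv.trans ih₁ ih₂
  | tensor _ _ ih₁ ih₂ => exact congrArg₂ blockSum ih₁ ih₂
  | tensor_id X Y => exact blockSum_refl _ _
  | tensor_comp f₁ f₂ g₁ g₂ => exact blockSum_trans _ _ _ _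
  | α_naturality f₁ f₂ f₃ => exact blockSum_assoc _ _ _
  | l_naturality f => exact blockSum_zero_left _
  | ρ_naturality f => exact blockSum_zero_right _
  | pentagon W X Y Z => exact blockSum_pentagon _ _ _ _
  | triangle X Y => exact blockSum_triangle _ _
  | β_naturality f g => exact blockSum_flip _ _
  | β_symmetry X Y => exact addFlip_addFlip _ _
  | hexagon_forward X Y Z => exact addFlip_hexagon_forward _ _ _
  | hexagon_reverse X Y Z => exact addFlip_hexagon_reverse _ _ _
  | _ => rfl

/-- The underlying permutation of a morphism of the free symmetric monoidal category. Source and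
target of a morphism have the same length `n`, so this is a bijection `[n] ≅ [n]`. -/
def perm {X Y : FreeSymMon A} (f : X ⟶ Y) : Fin X.length ≃ Fin Y.length :=
  Quotient.lift Hom.perm (fun _ _ h => Hom.perm_eq_of_homEquiv h) f

end FreeSymMon

/-!
A morphism `f : X ⟶ Y` of the free symmetric monoidal category can be analysed one atom at a time.
If `i` is an occurrence of an atom `a` in `X`, then the symmetries of the atoms to the left of `i`
provide an isomorphism `i.extract : X ≅ a ⊗ i.del` that pulls `i` to the front, where `i.del` is `X`
with `i` replaced by the unit. The main point is `exists_comp_extract`: if `f` carries `i` to the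
occurrence `j` in `Y`, then `f ≫ j.extract = i.extract ≫ (a ◁ f')` for some `f' : i.del ⟶ j.del`.
This is proved by induction on a formal expression for `f`; the cases of the generators are
naturality, unit and hexagon identities.

Let now `f` and `g` have the same underlying permutation. They carry `i` to the same `j`, since an
occurrence is determined by its position (`Occ.pos_injective`), and the restrictions `f'` and `g'`
again have equal permutations, since `perm` is functorial and `σ ⊕ τ` determines `τ`. As `i.del` has
one atom less than `X`, induction on the number of atoms gives `f' = g'`, hence `f = g`.
The induction starts with objects without atoms, which have an isomorphism to the unit that is
natural in all morphisms (`comp_isoUnit`). The argument needs neither strictification nor a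
presentation of the symmetric groups.
-/

/-! ### Pulling a factor out of a tensor product -/

section Extraction

variable {C : Type*} [Category C] [MonoidalCategory C] {a X X' Y Y' Z Z' : C}

/-- Given a way to pull a factor `a` out of `X`, pull it out of the left factor of `X ⊗ Y`. -/
def extractLeft (e : X ≅ a ⊗ X') (Y : C) : X ⊗ Y ≅ a ⊗ (X' ⊗ Y) :=
  whiskerRightIso e Y ≪≫ α_ a X' Y

/-- Inverting a compatibility square for an isomorphism `φ`; this reduces the inverses of the
associators and unitors, and one of the two braiding squares, to the other cases. -/
theorem inv_comp_extract {e : X ≅ a ⊗ X'} {e' : Y ≅ a ⊗ Y'} {φ : X ≅ Y} {φ' : X' ≅ Y'}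
    (h : φ.hom ≫ e'.hom = e.hom ≫ a ◁ φ'.hom) : φ.inv ≫ e.hom = e'.hom ≫ a ◁ φ'.inv := by
  rw [Iso.inv_comp_eq, ← Category.assoc, h, Category.assoc, ← MonoidalCategory.whiskerLeft_comp,
    Iso.hom_inv_id, MonoidalCategory.whiskerLeft_id, Category.comp_id]

theorem tensorHom_extractLeft {e : X ≅ a ⊗ X'} {e' : Y ≅ a ⊗ Y'} {f : X ⟶ Y} {f' : X' ⟶ Y'}
    (h : f ≫ e'.hom = e.hom ≫ a ◁ f') (g : Z ⟶ Z') :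
    (f ⊗ₘ g) ≫ (extractLeft e' Z').hom = (extractLeft e Z).hom ≫ a ◁ (f' ⊗ₘ g) := by
  simp only [extractLeft, Iso.trans_hom, whiskerRightIso_hom, Category.assoc]
  rw [MonoidalCategory.tensorHom_def', Category.assoc, ← comp_whiskerRight_assoc, h]
  simp [MonoidalCategory.tensorHom_def', whisker_exchange_assoc]

theorem associator_extract_left (e : X ≅ a ⊗ X') (Y Z : C) :
    (α_ X Y Z).hom ≫ (extractLeft e (Y ⊗ Z)).hom =
      (extractLeft (extractLeft e Y) Z).hom ≫ a ◁ (α_ X' Y Z).hom := by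
  simp [extractLeft]

theorem rightUnitor_extract (e : X ≅ a ⊗ X') :
    (ρ_ X).hom ≫ e.hom = (extractLeft e (𝟙_ C)).hom ≫ a ◁ (ρ_ X').hom := by
  simp [extractLeft]

variable [SymmetricCategory C]

/-- Given a way to pull a factor `a` out of `Y`, pull it out of the right factor of `X ⊗ Y`, past
`X` by means of the symmetry. -/
def extractRight (X : C) (e : Y ≅ a ⊗ Y') : X ⊗ Y ≅ a ⊗ (X ⊗ Y') :=
  whiskerLeftIso X e ≪≫ (α_ X a Y').symm ≪≫ whiskerRightIso (β_ X a) Y' ≪≫ α_ a X Y'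

theorem tensorHom_extractRight {e : X ≅ a ⊗ X'} {e' : Y ≅ a ⊗ Y'} {f : X ⟶ Y} {f' : X' ⟶ Y'}
    (h : f ≫ e'.hom = e.hom ≫ a ◁ f') (g : Z ⟶ Z') :
    (g ⊗ₘ f) ≫ (extractRight Z' e').hom = (extractRight Z e).hom ≫ a ◁ (g ⊗ₘ f') := by
  simp only [extractRight, Iso.trans_hom, Iso.symm_hom, whiskerLeftIso_hom, whiskerRightIso_hom,
    Category.assoc]
  rw [MonoidalCategory.tensorHom_def, Category.assoc, ← MonoidalCategory.whiskerLeft_comp_assoc, h]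
  simp only [MonoidalCategory.tensorHom_def, MonoidalCategory.whiskerLeft_comp, Category.assoc,
    associator_inv_naturality_right_assoc, whisker_exchange_assoc, ← whisker_exchange_assoc g,
    associator_inv_naturality_left_assoc, associator_naturality_right]
  rw [← comp_whiskerRight_assoc, BraidedCategory.braiding_naturality_left]
  simp

theorem associator_extract_middle (X : C) (e : Y ≅ a ⊗ Y') (Z : C) :
    (α_ X Y Z).hom ≫ (extractRight X (extractLeft e Z)).hom =
      (extractLeft (extractRight X e) Z).hom ≫ a ◁ (α_ X Y' Z).hom := by
  simp [extractLeft, extractRight]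

/-- Pulling `a` past `X ⊗ Y` at once agrees with pulling it past `Y` and then past `X`: this is the
hexagon identity. -/
theorem associator_extract_right (X Y : C) (e : Z ≅ a ⊗ Z') :
    (α_ X Y Z).hom ≫ (extractRight X (extractRight Y e)).hom =
      (extractRight (X ⊗ Y) e).hom ≫ a ◁ (α_ X Y Z').hom := by
  simp [extractRight]

theorem leftUnitor_extract (e : X ≅ a ⊗ X') :
    (λ_ X).hom ≫ e.hom = (extractRight (𝟙_ C) e).hom ≫ a ◁ (λ_ X').hom := by
  simp [extractRight]

/-- The hexagon identity for `X`, `a` and `Y'`, combined with the naturality of the braiding. -/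
theorem braiding_extract_right (X : C) (e : Y ≅ a ⊗ Y') :
    (β_ X Y).hom ≫ (extractLeft e X).hom = (extractRight X e).hom ≫ a ◁ (β_ X Y').hom := by
  simp only [extractLeft, extractRight, Iso.trans_hom, Iso.symm_hom, whiskerLeftIso_hom,
    whiskerRightIso_hom, Category.assoc]
  rw [← BraidedCategory.braiding_naturality_right_assoc, ← BraidedCategory.hexagon_forward X a Y',
    Iso.inv_hom_id_assoc]

theorem braiding_extract_left (e : X ≅ a ⊗ X') (Y : C) :
    (β_ X Y).hom ≫ (extractRight Y e).hom = (extractLeft e Y).hom ≫ a ◁ (β_ X' Y).hom := by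
  -- By symmetry of the braiding, this square is the inverse of `braiding_extract_right`.
  simpa only [SymmetricCategory.braiding_swap_eq_inv_braiding, Iso.symm_inv] using
    inv_comp_extract (φ := β_ Y X) (φ' := β_ Y X') (braiding_extract_right Y e)

end Extraction

/-! ### Occurrences of atoms -/

namespace FreeSymMon

variable {A : Type u}

/-- The occurrences of the atom `a` in an object. Indexing the type by `a` lets a morphism carry
occurrences to occurrences without transport along equalities of atoms. -/
inductive Occ (a : A) : FreeSymMon A → Type u
  | here : Occ a (of a)
  | left {X : FreeSymMon A} (i : Occ a X) (Y : FreeSymMon A) : Occ a (X.tensor Y)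
  | right (X : FreeSymMon A) {Y : FreeSymMon A} (i : Occ a Y) : Occ a (X.tensor Y)

namespace Occ

variable {a : A}

/-- The position of an occurrence in the list of all atoms of the object, counted from `0`. -/
def pos : ∀ {X : FreeSymMon A}, Occ a X → Fin X.length
  | _, here => (0 : Fin 1)
  | _, left i Y => Fin.castAdd Y.length i.pos
  | _, right X i => Fin.natAdd X.length i.pos

/-- The object with one occurrence of an atom replaced by the unit. No unitor is applied to
remove that unit, so `del` is compatible with `⊗` on the nose. -/
def del : ∀ {X : FreeSymMon A}, Occ a X → FreeSymMon A
  | _, here => unit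
  | _, left i Y => i.del.tensor Y
  | _, right X i => X.tensor i.del

/-- The isomorphism that pulls an occurrence of an atom out to the far left. -/
def extract : ∀ {X : FreeSymMon A} (i : Occ a X), X ≅ of a ⊗ i.del
  | _, here => (ρ_ (of a)).symm
  | _, left i Y => extractLeft i.extract Y
  | _, right X i => extractRight X i.extract

theorem pos_injective {X : FreeSymMon A} :
    ∀ i j : Occ a X, i.pos = j.pos → i = j := by
  intro i
  induction i with
  | here => rintro ⟨⟩ _; rfl
  | left i Y ih =>
    intro j h
    cases j with
    | left j => rw [ih j (Fin.castAdd_injective _ _ h)]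
    | right _ j =>
      have := congrArg Fin.val h
      simp only [pos, Fin.val_castAdd, Fin.val_natAdd] at this
      omega
  | right X i ih =>
    intro j h
    cases j with
    | left j =>
      have := congrArg Fin.val h
      simp only [pos, Fin.val_castAdd, Fin.val_natAdd] at this
      omega
    | right _ j => rw [ih j (Fin.natAdd_injective _ _ h)]

theorem exists_of_length_ne_zero :
    ∀ {X : FreeSymMon A}, X.length ≠ 0 → ∃ a, Nonempty (Occ a X)
  | of a, _ => ⟨a, ⟨here⟩⟩
  | unit, h => absurd rfl h
  | tensor X Y, h => by
    by_cases hX : X.length = 0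
    · obtain ⟨a, ⟨i⟩⟩ := exists_of_length_ne_zero (X := Y) fun hY => h (by simp [length, hX, hY])
      exact ⟨a, ⟨right X i⟩⟩
    · obtain ⟨a, ⟨i⟩⟩ := exists_of_length_ne_zero hX
      exact ⟨a, ⟨left i Y⟩⟩

end Occ

/-! ### Functoriality of the underlying permutation -/

theorem perm_comp {X Y Z : FreeSymMon A} (f : X ⟶ Y) (g : Y ⟶ Z) :
    perm (f ≫ g) = (perm f).trans (perm g) := by
  rcases f with ⟨f⟩; rcases g with ⟨g⟩; rfl

theorem perm_whiskerLeft (X : FreeSymMon A) {Y Z : FreeSymMon A} (f : Y ⟶ Z) :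
    perm (X ◁ f) = blockSum (Equiv.refl (Fin X.length)) (perm f) := by
  rcases f with ⟨f⟩; rfl

theorem perm_tensorHom {W X Y Z : FreeSymMon A} (f : W ⟶ Y) (g : X ⟶ Z) :
    perm (f ⊗ₘ g) = blockSum (perm f) (perm g) := by
  rcases f with ⟨f⟩; rcases g with ⟨g⟩; rfl

theorem length_eq {X Y : FreeSymMon A} (f : X ⟶ Y) : X.length = Y.length :=
  Fin.equiv_iff_eq.mp ⟨perm f⟩

theorem blockSum_castAdd {m n m' n' : ℕ} (σ : Fin m ≃ Fin m') (τ : Fin n ≃ Fin n') (i : Fin m) :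
    blockSum σ τ (Fin.castAdd n i) = Fin.castAdd n' (σ i) := by
  simp [blockSum]

theorem blockSum_natAdd {m n m' n' : ℕ} (σ : Fin m ≃ Fin m') (τ : Fin n ≃ Fin n') (i : Fin n) :
    blockSum σ τ (Fin.natAdd m i) = Fin.natAdd m' (τ i) := by
  simp [blockSum]

theorem blockSum_right_injective {m n m' n' : ℕ} (σ : Fin m ≃ Fin m') :
    Function.Injective (blockSum σ : (Fin n ≃ Fin n') → _) := by
  intro τ τ' h
  ext1 i
  apply Fin.natAdd_injective _ m'
  rw [← blockSum_natAdd σ, ← blockSum_natAdd σ, h]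

/-! ### Restriction of a morphism to the complement of an atom -/

/-- Induction on the formal expression representing a morphism. -/
theorem hom_induction {P : ∀ X Y : FreeSymMon A, (X ⟶ Y) → Prop}
    (id : ∀ X, P X X (𝟙 X))
    (comp : ∀ X Y Z (f : X ⟶ Y) (g : Y ⟶ Z), P X Y f → P Y Z g → P X Z (f ≫ g))
    (tensor : ∀ W X Y Z (f : W ⟶ Y) (g : X ⟶ Z), P W Y f → P X Z g →
      P (W ⊗ X) (Y ⊗ Z) (f ⊗ₘ g))
    (α_hom : ∀ X Y Z, P _ _ (α_ X Y Z).hom) (α_inv : ∀ X Y Z, P _ _ (α_ X Y Z).inv)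
    (l_hom : ∀ X, P _ _ (λ_ X).hom) (l_inv : ∀ X, P _ _ (λ_ X).inv)
    (ρ_hom : ∀ X, P _ _ (ρ_ X).hom) (ρ_inv : ∀ X, P _ _ (ρ_ X).inv)
    (β : ∀ X Y, P _ _ (β_ X Y).hom) {X Y : FreeSymMon A} (f : X ⟶ Y) : P X Y f := by
  obtain ⟨f, rfl⟩ := Quotient.exists_rep f
  induction f with
  | id X => exact id X
  | comp f g ihf ihg => exact comp _ _ _ _ _ ihf ihg
  | tensor f g ihf ihg => exact tensor _ _ _ _ _ _ ihf ihg
  | α_hom X Y Z => exact α_hom X Y Z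
  | α_inv X Y Z => exact α_inv X Y Z
  | l_hom X => exact l_hom X
  | l_inv X => exact l_inv X
  | ρ_hom X => exact ρ_hom X
  | ρ_inv X => exact ρ_inv X
  | β X Y => exact β X Y

/-- Every morphism is compatible with pulling out an atom `i`: it carries `i` to an occurrence `j`
of the same atom, at the position prescribed by the underlying permutation, and restricts to a
morphism between the objects with `i` and `j` deleted. -/
theorem exists_comp_extract {a : A} {X Y : FreeSymMon A} (f : X ⟶ Y) (i : Occ a X) :
    ∃ j : Occ a Y, j.pos = perm f i.pos ∧
      ∃ f' : i.del ⟶ j.del, f ≫ j.extract.hom = i.extract.hom ≫ of a ◁ f' := by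
  induction f using hom_induction with
  | id X => exact ⟨i, rfl, 𝟙 _, by simp⟩
  | comp X Y Z f g ihf ihg =>
    obtain ⟨j, hj, f', hf⟩ := ihf i
    obtain ⟨k, hk, g', hg⟩ := ihg j
    refine ⟨k, ?_, f' ≫ g', ?_⟩
    · rw [hk, hj, perm_comp, Equiv.trans_apply]
    · rw [Category.assoc, hg, ← Category.assoc, hf, Category.assoc,
        MonoidalCategory.whiskerLeft_comp]
  | tensor W X Y Z f g ihf ihg =>
    cases i with
    | left i =>
      obtain ⟨j, hj, f', hf⟩ := ihf i
      refine ⟨j.left _, ?_, _, tensorHom_extractLeft hf g⟩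
      rw [perm_tensorHom]
      exact (congrArg (Fin.castAdd _) hj).trans (blockSum_castAdd _ _ _).symm
    | right _ i =>
      obtain ⟨j, hj, g', hg⟩ := ihg i
      refine ⟨j.right _, ?_, _, tensorHom_extractRight hg f⟩
      rw [perm_tensorHom]
      exact (congrArg (Fin.natAdd _) hj).trans (blockSum_natAdd _ _ _).symm
  | α_hom X Y Z =>
    rcases i with _ | ⟨_ | ⟨i, _⟩ | ⟨_, i⟩, _⟩ | ⟨_, i⟩
    · exact ⟨i.left _, rfl, _, associator_extract_left i.extract Y Z⟩
    · exact ⟨(i.left _).right _, rfl, _, associator_extract_middle X i.extract Z⟩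
    · exact ⟨(i.right _).right _, Fin.ext (Nat.add_assoc _ _ _).symm, _,
        associator_extract_right X Y i.extract⟩
  | α_inv X Y Z =>
    rcases i with _ | ⟨i, _⟩ | ⟨_, _ | ⟨i, _⟩ | ⟨_, i⟩⟩
    · exact ⟨(i.left _).left _, rfl, _, inv_comp_extract (associator_extract_left i.extract Y Z)⟩
    · exact ⟨(i.right _).left _, rfl, _,
        inv_comp_extract (associator_extract_middle X i.extract Z)⟩
    · exact ⟨i.right _, Fin.ext (Nat.add_assoc _ _ _), _,
        inv_comp_extract (associator_extract_right X Y i.extract)⟩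
  | l_hom X =>
    rcases i with _ | ⟨⟨⟩, _⟩ | ⟨_, i⟩
    exact ⟨i, Fin.ext (Nat.zero_add _).symm, _, leftUnitor_extract i.extract⟩
  | l_inv X =>
    exact ⟨i.right _, Fin.ext (Nat.zero_add _), _, inv_comp_extract (leftUnitor_extract i.extract)⟩
  | ρ_hom X =>
    rcases i with _ | ⟨i, _⟩ | ⟨_, ⟨⟩⟩
    exact ⟨i, rfl, _, rightUnitor_extract i.extract⟩
  | ρ_inv X => exact ⟨i.left _, rfl, _, inv_comp_extract (rightUnitor_extract i.extract)⟩
  | β X Y =>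
    rcases i with _ | ⟨i, _⟩ | ⟨_, i⟩
    · exact ⟨i.right _, (finAddFlip_apply_castAdd _ _).symm, _, braiding_extract_left i.extract Y⟩
    · exact ⟨i.left _, (finAddFlip_apply_natAdd _ _).symm, _, braiding_extract_right X i.extract⟩

/-! ### Objects without atoms -/

/-- The canonical isomorphism from an object without atoms to the unit. -/
def isoUnit : ∀ X : FreeSymMon A, X.length = 0 → (X ≅ 𝟙_ (FreeSymMon A))
  | of _, h => absurd h Nat.one_ne_zero
  | unit, _ => Iso.refl _
  | tensor X Y, h =>
    (isoUnit X (Nat.add_eq_zero_iff.mp h).1 ⊗ᵢ isoUnit Y (Nat.add_eq_zero_iff.mp h).2) ≪≫ λ_ _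

theorem isoUnit_unit_hom (h) : (isoUnit (𝟙_ (FreeSymMon A)) h).hom = 𝟙 _ := rfl

theorem isoUnit_tensor_hom (X Y : FreeSymMon A) (h : (X ⊗ Y).length = 0) :
    (isoUnit (X ⊗ Y) h).hom = ((isoUnit X (Nat.add_eq_zero_iff.mp h).1).hom ⊗ₘ
      (isoUnit Y (Nat.add_eq_zero_iff.mp h).2).hom) ≫ (λ_ _).hom := rfl

theorem associator_comp_isoUnit (X Y Z : FreeSymMon A) (h : ((X ⊗ Y) ⊗ Z).length = 0)
    (h' : (X ⊗ Y ⊗ Z).length = 0) :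
    (α_ X Y Z).hom ≫ (isoUnit (X ⊗ Y ⊗ Z) h').hom = (isoUnit ((X ⊗ Y) ⊗ Z) h).hom := by
  simp only [isoUnit_tensor_hom]
  set x := (isoUnit X _).hom
  set y := (isoUnit Y _).hom
  set z := (isoUnit Z _).hom
  have hl : x ⊗ₘ ((y ⊗ₘ z) ≫ (λ_ _).hom) = (x ⊗ₘ (y ⊗ₘ z)) ≫ (𝟙_ _ ◁ (λ_ _).hom) := by
    rw [← id_tensorHom, tensorHom_comp_tensorHom, Category.comp_id]
  have hr : ((x ⊗ₘ y) ≫ (λ_ _).hom) ⊗ₘ z = ((x ⊗ₘ y) ⊗ₘ z) ≫ ((λ_ _).hom ▷ 𝟙_ _) := by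
    rw [← tensorHom_id, tensorHom_comp_tensorHom, Category.comp_id]
  rw [hl, hr, Category.assoc, Category.assoc, ← associator_naturality_assoc]
  -- What remains is an identity between structural morphisms on tensor powers of the unit.
  congr 1
  monoidal

theorem leftUnitor_comp_isoUnit (X : FreeSymMon A) (h : (𝟙_ (FreeSymMon A) ⊗ X).length = 0)
    (h' : X.length = 0) :
    (λ_ X).hom ≫ (isoUnit X h').hom = (isoUnit (𝟙_ (FreeSymMon A) ⊗ X) h).hom := by
  rw [isoUnit_tensor_hom, isoUnit_unit_hom, id_tensorHom, leftUnitor_naturality]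

theorem rightUnitor_comp_isoUnit (X : FreeSymMon A) (h : (X ⊗ 𝟙_ (FreeSymMon A)).length = 0)
    (h' : X.length = 0) :
    (ρ_ X).hom ≫ (isoUnit X h').hom = (isoUnit (X ⊗ 𝟙_ (FreeSymMon A)) h).hom := by
  rw [isoUnit_tensor_hom, isoUnit_unit_hom, tensorHom_id, unitors_equal, rightUnitor_naturality]

/-- The isomorphisms `isoUnit` are natural in all morphisms, so two parallel morphisms between
objects without atoms are equal. -/
theorem comp_isoUnit {X Y : FreeSymMon A} (f : X ⟶ Y) (hX : X.length = 0) (hY : Y.length = 0) :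
    f ≫ (isoUnit Y hY).hom = (isoUnit X hX).hom := by
  induction f using hom_induction with
  | id X => exact Category.id_comp _
  | comp X Y Z f g ihf ihg =>
    rw [Category.assoc, ihg ((length_eq f).symm.trans hX) hY, ihf]
  | tensor W X Y Z f g ihf ihg =>
    rw [isoUnit_tensor_hom, isoUnit_tensor_hom, tensorHom_comp_tensorHom_assoc, ihf, ihg]
  | α_hom X Y Z => exact associator_comp_isoUnit _ _ _ _ _
  | α_inv X Y Z => rw [Iso.inv_comp_eq, associator_comp_isoUnit]
  | l_hom X => exact leftUnitor_comp_isoUnit _ _ _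
  | l_inv X => rw [Iso.inv_comp_eq, leftUnitor_comp_isoUnit]
  | ρ_hom X => exact rightUnitor_comp_isoUnit _ _ _
  | ρ_inv X => rw [Iso.inv_comp_eq, rightUnitor_comp_isoUnit]
  | β X Y =>
    rw [isoUnit_tensor_hom, isoUnit_tensor_hom, ← BraidedCategory.braiding_naturality_assoc]
    simp [← unitors_equal]

end FreeSymMon

/-! ### Coherence -/

theorem mainTheorem7 {A : Type u} {X Y : FreeSymMon A} (f g : X ⟶ Y)
    (h : FreeSymMon.perm f = FreeSymMon.perm g) : f = g := by
  induction hn : X.length generalizing X Y with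
  | zero =>
    have hY := (FreeSymMon.length_eq f).symm.trans hn
    rw [← cancel_mono (FreeSymMon.isoUnit Y hY).hom, FreeSymMon.comp_isoUnit f hn hY,
      FreeSymMon.comp_isoUnit g hn hY]
  | succ n ih =>
    obtain ⟨a, ⟨i⟩⟩ := FreeSymMon.Occ.exists_of_length_ne_zero (X := X) (by omega)
    obtain ⟨j, hj, f', hf⟩ := FreeSymMon.exists_comp_extract f i
    obtain ⟨k, hk, g', hg⟩ := FreeSymMon.exists_comp_extract g i
    obtain rfl : j = k := FreeSymMon.Occ.pos_injective _ _ (by rw [hj, hk, h])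
    have hlen : X.length = 1 + i.del.length := FreeSymMon.length_eq i.extract.hom
    -- In `i.extract.hom ≫ of a ◁ f' = f ≫ j.extract.hom` everything but `f'` is shared with `g`, so
    -- the permutations of `of a ◁ f'` and `of a ◁ g'` agree.
    have hperm : FreeSymMon.perm f' = FreeSymMon.perm g' := by
      apply FreeSymMon.blockSum_right_injective
      rw [← FreeSymMon.perm_whiskerLeft, ← FreeSymMon.perm_whiskerLeft]
      have key : (FreeSymMon.perm i.extract.hom).trans (FreeSymMon.perm (FreeSymMon.of a ◁ f')) =
          (FreeSymMon.perm i.extract.hom).trans (FreeSymMon.perm (FreeSymMon.of a ◁ g')) := by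
        rw [← FreeSymMon.perm_comp, ← FreeSymMon.perm_comp, ← hf, ← hg, FreeSymMon.perm_comp,
          FreeSymMon.perm_comp, h]
      ext x
      simpa using congrArg Fin.val
        (DFunLike.congr_fun key ((FreeSymMon.perm i.extract.hom).symm x))
    rw [← cancel_mono j.extract.hom, hf, hg, ih f' g' hperm (by omega)]
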